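/- Let $n \ge 0$ be an integer and let $\mathbb{C}[P]$ be the polynomial ring over $\mathbb{C}$ in the $\binom{n+1}{2}$ entries $p_{ij} = p_{ji}$ of a symmetric $n \times n$ matrix $P = (p_{ij})$ of unknowns. Let $I_n \subseteq \mathbb{C}[P]$ be the ideal generated by the entries of $P^2 - P$ and, for an integer $d$ with $0 \le d \le n$, let $I_{n,d} = I_n + \langle \operatorname{trace}(P) - d \rangle$. The projection Grassmannian is the affine variety $\mathrm{pGr}(d,n) = V(I_{n,d})$, the set of all common zeros of $I_{n,d}$ in the space $\mathbb{C}^{\binom{n+1}{2}}$ of complex symmetric $n \times n$ matrices. Then: 1. The ideal $I_n$ is radical, and the affine scheme $\operatorname{Spec}(\mathbb{C}[P]/I_n)$ is smooth over $\mathbb{C}$. 2. For every $d$ with $0 \le d \le n$, the ideal $I_{n,d}$ is prime, it is equal to the ideal of all polynomials in $\mathbb{C}[P]$ that vanish on $\mathrm{pGr}(d,n)$, and the affine scheme $\operatorname{Spec}(\mathbb{C}[P]/I_{n,d})$ is smooth over $\mathbb{C}$. -/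

import Mathlib

/-- The coordinate ring `ℂ[P]` of the space of symmetric `n × n` matrices: one unknown for each
unordered pair `{i, j}` of indices (with `i = j` allowed), so `n (n + 1) / 2` unknowns. -/
abbrev SymMatRing (n : ℕ) : Type := MvPolynomial (Sym2 (Fin n)) ℂ

/-- The generic symmetric `n × n` matrix `P = (p_{ij})` over `ℂ[P]`, with `p_{ij} = p_{ji}`. -/
noncomputable def genericSymm (n : ℕ) : Matrix (Fin n) (Fin n) (SymMatRing n) :=
  Matrix.of fun i j => MvPolynomial.X s(i, j)

/-- The ideal `I_n` of `ℂ[P]` generated by the entries of `P ^ 2 - P`. -/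
noncomputable def idempotentIdeal (n : ℕ) : Ideal (SymMatRing n) :=
  Ideal.span {f | ∃ i j : Fin n, f = (genericSymm n ^ 2 - genericSymm n) i j}

/-- The ideal `I_{n,d} = I_n + ⟨trace P - d⟩` of `ℂ[P]`. -/
noncomputable def projectionIdeal (d n : ℕ) : Ideal (SymMatRing n) :=
  idempotentIdeal n ⊔ Ideal.span {(genericSymm n).trace - (d : SymMatRing n)}

/-- The projection Grassmannian `pGr(d, n) = V(I_n + ⟨trace P - d⟩)`, as a subset of the complex
affine space of symmetric `n × n` matrices. -/
def pGr (d n : ℕ) : Set (Sym2 (Fin n) → ℂ) :=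
  MvPolynomial.zeroLocus ℂ (projectionIdeal d n)

/-!
For an idempotent matrix `E` the polynomial `f = det (1 - E + u E)` in `u` satisfies
`f (u v) = f u * f v`, hence `u * df/du = trace E * f`: the coefficient of degree `k` is killed by
`trace E - k`, while all coefficients add up to `1`. So the integer values of the trace decompose
the ring. In characteristic zero the trace is moreover rigid under nilpotent perturbation, and if it
is `d` then `f = u ^ d`, so that the principal minors of `E` of size `d` add up to `1`.

Smoothness: symmetric idempotents lift along square-zero extensions, and the trace of the lift is
rigid. Primality: where a principal minor of `P` of size `d` is invertible, `P` is the orthogonal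
projection `Aᵀ (A Aᵀ)⁻¹ A` onto the span of the chosen rows, so `I_{n,d}` is the kernel of
`P ↦ Aᵀ (A Aᵀ)⁻¹ A` into the domain `ℂ[A, det (A Aᵀ)⁻¹]`. Radicality: `I_n` is the intersection of
the prime ideals `I_{n,d}`.
-/

open Polynomial Matrix

section RankPolynomial

variable {m S : Type*} [Fintype m] [DecidableEq m] [CommRing S] {E : Matrix m m S}

/-- The polynomial `det (1 - E + u E)` in the variable `u`. If `E` is idempotent, its
coefficient of degree `k` is the idempotent that cuts out the locus where `E` has rank `k`. -/
noncomputable def rankPoly (E : Matrix m m S) : S[X] :=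
  det (1 + (X - 1 : S[X]) • E.map C)

lemma aeval_rankPoly {T : Type*} [CommRing T] [Algebra S T] (E : Matrix m m S) (u : T) :
    aeval u (rankPoly E) = det (1 + (u - 1) • E.map (algebraMap S T)) := by
  rw [rankPoly, AlgHom.map_det]
  congr 1
  ext i j
  simp [Matrix.one_apply, apply_ite (aeval u)]

lemma rankPoly_comp_one_add_X (E : Matrix m m S) :
    (rankPoly E).comp (1 + X) = det (1 + (X : S[X]) • E.map C) := by
  rw [comp_eq_aeval, aeval_rankPoly, add_sub_cancel_left, Polynomial.algebraMap_eq]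

lemma eval_one_rankPoly (E : Matrix m m S) : (rankPoly E).eval 1 = 1 := by
  simpa using aeval_rankPoly E (1 : S)

lemma eval_one_derivative_rankPoly (E : Matrix m m S) :
    (derivative (rankPoly E)).eval 1 = E.trace := by
  rw [← derivative_det_one_add_X_smul, ← rankPoly_comp_one_add_X, derivative_comp]
  simp

lemma natDegree_rankPoly_le (E : Matrix m m S) : (rankPoly E).natDegree ≤ Fintype.card m := by
  have h : rankPoly E = det ((X : S[X]) • E.map C + (1 - E).map C) := by
    rw [rankPoly, Matrix.map_sub C (map_sub C), Matrix.map_one C (map_zero C) (map_one C), sub_smul,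
      one_smul, add_sub_left_comm]
  exact h ▸ natDegree_det_X_add_C_le E (1 - E)

lemma sum_coeff_rankPoly (E : Matrix m m S) :
    ∑ k : Fin (Fintype.card m + 1), (rankPoly E).coeff k = 1 := by
  rw [Fin.sum_univ_eq_sum_range, ← eval_one_rankPoly E,
    eval_eq_sum_range' (Nat.lt_succ_of_le (natDegree_rankPoly_le E))]
  simp

lemma aeval_mul_rankPoly {T : Type*} [CommRing T] [Algebra S T] (hE : IsIdempotentElem E)
    (u v : T) :
    aeval (u * v) (rankPoly E) = aeval u (rankPoly E) * aeval v (rankPoly E) := by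
  have hF : E.map (algebraMap S T) * E.map (algebraMap S T) = E.map (algebraMap S T) :=
    hE.map (algebraMap S T).mapMatrix
  rw [aeval_rankPoly, aeval_rankPoly, aeval_rankPoly, ← det_mul, add_mul, one_mul, mul_add, mul_one,
    smul_mul_smul_comm, hF]
  congr 1
  module

/-- Differentiate `f (u v) = f u * f v` with respect to `v` at `v = 1`. -/
lemma X_mul_derivative_rankPoly (hE : IsIdempotentElem E) :
    X * derivative (rankPoly E) = C E.trace * rankPoly E := by
  set q : S[X][X] := (rankPoly E).map C with hq
  have aeval_eq (w : S[X][X]) : aeval w (rankPoly E) = q.comp w := by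
    rw [hq, Polynomial.comp, eval₂_map]
    rfl
  have hmul : q.comp (C X * X) = C (rankPoly E) * q := by
    have h := aeval_mul_rankPoly hE (C X : S[X][X]) X
    rw [aeval_eq, aeval_eq, aeval_eq, comp_X, comp_C] at h
    rw [h, hq, eval_map, eval₂_C_X]
  have hderiv := congrArg (fun p => (derivative p).eval 1) hmul
  simp only [derivative_comp, derivative_C_mul, derivative_X, mul_one, eval_mul, eval_C, eval_comp,
    eval_X] at hderiv
  rw [hq, derivative_map, eval_map, eval₂_C_X, eval_one_map, eval_one_derivative_rankPoly] at hderiv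
  rw [hderiv, mul_comm]

lemma trace_sub_natCast_mul_coeff_rankPoly (hE : IsIdempotentElem E) (k : ℕ) :
    (E.trace - k) * (rankPoly E).coeff k = 0 := by
  have h := congrArg (coeff · k) (X_mul_derivative_rankPoly hE)
  cases k with
  | zero => simpa using h.symm
  | succ k =>
    simp only [coeff_X_mul, coeff_derivative, coeff_C_mul] at h
    rw [sub_mul, ← h, Nat.cast_succ]
    ring

variable [Algebra ℚ S]

lemma rankPoly_eq_X_pow (hE : IsIdempotentElem E) {d : ℕ} (hd : IsNilpotent (E.trace - d)) :
    rankPoly E = X ^ d := by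
  have hzero (k : ℕ) (hk : k ≠ d) : (rankPoly E).coeff k = 0 := by
    have hdk : IsUnit ((d : S) - k) := by
      have : IsUnit ((d : ℚ) - k) := isUnit_iff_ne_zero.mpr (sub_ne_zero.mpr (mod_cast hk.symm))
      simpa using this.map (algebraMap ℚ S)
    have hunit : IsUnit (E.trace - k) := by
      simpa using hd.isUnit_add_left_of_commute hdk (Commute.all _ _)
    exact hunit.mul_right_eq_zero.mp (trace_sub_natCast_mul_coeff_rankPoly hE k)
  have hmon : rankPoly E = C ((rankPoly E).coeff d) * X ^ d := by
    ext k
    rw [coeff_C_mul_X_pow]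
    split_ifs with hk
    · rw [hk]
    · exact hzero k hk
  have hone : (rankPoly E).coeff d = 1 := by
    have h := congrArg (eval 1) hmon
    rw [eval_one_rankPoly] at h
    simpa using h.symm
  rw [hmon, hone, C_1, one_mul]

lemma sum_det_principal_submatrix_eq_one (hE : IsIdempotentElem E) {d : ℕ} (ht : E.trace = d) :
    ∑ s ∈ Finset.univ.powersetCard d,
      (E.submatrix (Subtype.val : s → m) (Subtype.val : s → m)).det = 1 := by
  rw [← coeff_det_one_add_X_smul_eq_sum_minors, ← rankPoly_comp_one_add_X,
    rankPoly_eq_X_pow hE (d := d) (by simp [ht]), X_pow_comp, coeff_one_add_X_pow, Nat.choose_self,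
    Nat.cast_one]

end RankPolynomial

section IdempotentMatrix

variable {m S : Type*} [Fintype m] [CommRing S] {E : Matrix m m S}

lemma iInf_span_trace_sub_natCast_eq_bot (hE : IsIdempotentElem E) :
    ⨅ k : Fin (Fintype.card m + 1), Ideal.span {E.trace - (k : S)} = ⊥ := by
  classical
  refine eq_bot_iff.mpr fun x hx => ?_
  rw [Ideal.mem_bot, ← mul_one x, ← sum_coeff_rankPoly E, Finset.mul_sum]
  refine Finset.sum_eq_zero fun k _ => ?_
  obtain ⟨y, rfl⟩ := Ideal.mem_span_singleton'.mp (Ideal.mem_iInf.mp hx k)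
  rw [mul_assoc, trace_sub_natCast_mul_coeff_rankPoly hE, mul_zero]

variable [Algebra ℚ S]

lemma trace_eq_natCast_of_isNilpotent_sub (hE : IsIdempotentElem E) {d : ℕ}
    (hd : IsNilpotent (E.trace - d)) : E.trace = d := by
  classical
  rw [← eval_one_derivative_rankPoly, rankPoly_eq_X_pow hE hd, derivative_X_pow]
  simp

lemma eq_zero_of_isIdempotentElem_of_trace_eq_zero (hE : IsIdempotentElem E)
    (ht : E.trace = 0) : E = 0 := by
  classical
  have hdet : det (1 - E) = 1 := by
    have h := aeval_rankPoly E (0 : S)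
    rw [rankPoly_eq_X_pow hE (d := 0) (by simp [ht])] at h
    simpa [← sub_eq_add_neg] using h.symm
  have hunit : IsUnit (1 - E) := (isUnit_iff_isUnit_det _).mpr (hdet ▸ isUnit_one)
  exact hunit.mul_right_eq_zero.mp hE.one_sub_mul_self

lemma span_det_submatrix_eq_top {k : Type*} [Fintype k] [DecidableEq k] (hE : IsIdempotentElem E)
    (ht : E.trace = Fintype.card k) :
    Ideal.span (Set.range fun a : k → m => (E.submatrix a a).det) = ⊤ := by
  classical
  rw [Ideal.eq_top_iff_one, ← sum_det_principal_submatrix_eq_one hE ht]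
  refine Ideal.sum_mem _ fun s hs => Ideal.subset_span ?_
  have hcard : Fintype.card k = Fintype.card s := by
    rw [Fintype.card_coe, (Finset.mem_powersetCard.mp hs).2]
  let e : k ≃ s := Fintype.equivOfCardEq hcard
  exact ⟨Subtype.val ∘ e, det_submatrix_equiv_self e (E.submatrix Subtype.val Subtype.val)⟩

end IdempotentMatrix

section RowProjection

variable {k m S : Type*} [Fintype k] [DecidableEq k] [Fintype m] [CommRing S]

/-- The matrix `Aᵀ (A Aᵀ)⁻¹ A` of the orthogonal projection onto the row space of `A`. It is
meaningful only if `A Aᵀ` is invertible, since `⁻¹` is `0` otherwise. -/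
noncomputable def rowProj (A : Matrix k m S) : Matrix m m S :=
  Aᵀ * (A * Aᵀ)⁻¹ * A

lemma isSymm_rowProj (A : Matrix k m S) : (rowProj A).IsSymm := by
  simp [rowProj, IsSymm, transpose_nonsing_inv, Matrix.mul_assoc]

variable {A : Matrix k m S}

lemma mul_rowProj (hA : IsUnit (A * Aᵀ).det) : A * rowProj A = A := by
  rw [rowProj, ← Matrix.mul_assoc, ← Matrix.mul_assoc, mul_nonsing_inv _ hA, Matrix.one_mul]

lemma rowProj_mul_of_mul_eq {P : Matrix m m S} (hAP : A * P = A) : rowProj A * P = rowProj A := by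
  rw [rowProj, Matrix.mul_assoc, hAP]

lemma isIdempotentElem_rowProj (hA : IsUnit (A * Aᵀ).det) : IsIdempotentElem (rowProj A) :=
  rowProj_mul_of_mul_eq (mul_rowProj hA)

lemma trace_rowProj (hA : IsUnit (A * Aᵀ).det) : (rowProj A).trace = Fintype.card k := by
  rw [rowProj, Matrix.mul_assoc, trace_mul_comm, Matrix.mul_assoc, nonsing_inv_mul _ hA, trace_one]

lemma det_map_mul_transpose_map {T : Type*} [CommRing T] (f : S →+* T) (A : Matrix k m S) :
    (A.map f * (A.map f)ᵀ).det = f (A * Aᵀ).det := by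
  rw [RingHom.map_det, RingHom.mapMatrix_apply, Matrix.map_mul, Matrix.transpose_map]

lemma map_rowProj {T : Type*} [CommRing T] (f : S →+* T) (hA : IsUnit (A * Aᵀ).det) :
    (rowProj A).map f = rowProj (A.map f) := by
  have hinv : ((A * Aᵀ)⁻¹).map f = (A.map f * (A.map f)ᵀ)⁻¹ := by
    refine (inv_eq_right_inv ?_).symm
    rw [← transpose_map, ← Matrix.map_mul, ← Matrix.map_mul, mul_nonsing_inv _ hA,
      Matrix.map_one f f.map_zero f.map_one]
  rw [rowProj, Matrix.map_mul, Matrix.map_mul, hinv, transpose_map, rowProj]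

lemma submatrix_mul_transpose_submatrix {P : Matrix m m S} (hs : P.IsSymm)
    (hP : IsIdempotentElem P) {l : Type*} (a : l → m) :
    P.submatrix a id * (P.submatrix a id)ᵀ = P.submatrix a a := by
  rw [transpose_submatrix, hs.eq, ← submatrix_mul _ _ a id a Function.bijective_id, hP.eq]

lemma rowProj_eq_of_mul_eq [Algebra ℚ S] {P : Matrix m m S} (hs : P.IsSymm)
    (hP : IsIdempotentElem P) (ht : P.trace = Fintype.card k) (hA : IsUnit (A * Aᵀ).det)
    (hAP : A * P = A) : rowProj A = P := by
  classical
  have hQP : rowProj A * P = rowProj A := rowProj_mul_of_mul_eq hAP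
  have hPQ : P * rowProj A = rowProj A := by
    simpa [transpose_mul, hs.eq, (isSymm_rowProj A).eq] using congrArg transpose hQP
  have hsub : P - rowProj A = 0 :=
    eq_zero_of_isIdempotentElem_of_trace_eq_zero ((isIdempotentElem_rowProj hA).sub hP hQP hPQ)
      (by rw [trace_sub, ht, trace_rowProj hA, sub_self])
  exact (sub_eq_zero.mp hsub).symm

lemma rowProj_submatrix [Algebra ℚ S] {P : Matrix m m S} (hs : P.IsSymm)
    (hP : IsIdempotentElem P) (ht : P.trace = Fintype.card k) (a : k → m)
    (ha : IsUnit (P.submatrix a a).det) : rowProj (P.submatrix a id) = P := by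
  refine rowProj_eq_of_mul_eq hs hP ht (by rwa [submatrix_mul_transpose_submatrix hs hP]) ?_
  simpa [hP.eq] using (submatrix_mul P P a id id Function.bijective_id).symm

end RowProjection

section GenericSymmetricMatrix

variable (ι K : Type*) [CommRing K]

/-- The generic symmetric matrix `P = (p_{ij})` with rows and columns indexed by `ι`, over the
polynomial ring in one unknown for each unordered pair of indices. -/
noncomputable def symmMvPolynomialX : Matrix ι ι (MvPolynomial (Sym2 ι) K) :=
  Matrix.of fun i j => MvPolynomial.X s(i, j)

/-- The ideal generated by the entries of `P ^ 2 - P` for the generic symmetric matrix `P`. -/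
noncomputable def symmIdempotentIdeal [Fintype ι] [DecidableEq ι] :
    Ideal (MvPolynomial (Sym2 ι) K) :=
  Ideal.span {f | ∃ i j, f = (symmMvPolynomialX ι K ^ 2 - symmMvPolynomialX ι K) i j}

/-- The ideal generated by the entries of `P ^ 2 - P` and by `trace P - d`, for the generic
symmetric matrix `P`. -/
noncomputable def symmProjectionIdeal [Fintype ι] [DecidableEq ι] (d : ℕ) :
    Ideal (MvPolynomial (Sym2 ι) K) :=
  symmIdempotentIdeal ι K ⊔
    Ideal.span {(symmMvPolynomialX ι K).trace - (d : MvPolynomial (Sym2 ι) K)}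

variable {ι} {S : Type*} [CommRing S] [Algebra K S]

/-- The substitution of a symmetric matrix for the generic symmetric matrix. -/
noncomputable def symmAeval {E : Matrix ι ι S} (hE : E.IsSymm) :
    MvPolynomial (Sym2 ι) K →ₐ[K] S :=
  MvPolynomial.aeval (Sym2.lift ⟨fun i j => E i j, fun i j => (hE.apply i j).symm⟩)

variable {K}

lemma symmMvPolynomialX_map_symmAeval {E : Matrix ι ι S} (hE : E.IsSymm) :
    (symmMvPolynomialX ι K).map (symmAeval K hE) = E := by
  ext i j
  simp [symmMvPolynomialX, symmAeval]

lemma algHom_ext_of_map_symmMvPolynomialX_eq {φ ψ : MvPolynomial (Sym2 ι) K →ₐ[K] S}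
    (h : (symmMvPolynomialX ι K).map φ = (symmMvPolynomialX ι K).map ψ) : φ = ψ := by
  refine MvPolynomial.algHom_ext fun s => ?_
  induction s with
  | _ i j => exact congrFun (congrFun h i) j

lemma isSymm_map_symmMvPolynomialX (φ : MvPolynomial (Sym2 ι) K →ₐ[K] S) :
    ((symmMvPolynomialX ι K).map φ).IsSymm := by
  ext i j
  simp [symmMvPolynomialX, Sym2.eq_swap]

variable [Fintype ι]

lemma trace_map_symmMvPolynomialX (φ : MvPolynomial (Sym2 ι) K →ₐ[K] S) :
    ((symmMvPolynomialX ι K).map φ).trace = φ (symmMvPolynomialX ι K).trace :=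
  (AddMonoidHom.map_trace φ _).symm

variable [DecidableEq ι]

lemma symmIdempotentIdeal_le_ker_iff (φ : MvPolynomial (Sym2 ι) K →ₐ[K] S) :
    symmIdempotentIdeal ι K ≤ RingHom.ker φ ↔
      IsIdempotentElem ((symmMvPolynomialX ι K).map φ) := by
  have hmap : φ.mapMatrix (symmMvPolynomialX ι K ^ 2 - symmMvPolynomialX ι K) =
      (symmMvPolynomialX ι K).map φ * (symmMvPolynomialX ι K).map φ -
        (symmMvPolynomialX ι K).map φ := by
    rw [map_sub, map_pow, sq]
    rfl
  rw [IsIdempotentElem, ← sub_eq_zero, ← hmap, symmIdempotentIdeal, Ideal.span_le, ← Matrix.ext_iff]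
  refine ⟨fun h i j => h ⟨i, j, rfl⟩, ?_⟩
  rintro h _ ⟨i, j, rfl⟩
  exact h i j

lemma symmProjectionIdeal_le_ker_iff (d : ℕ) (φ : MvPolynomial (Sym2 ι) K →ₐ[K] S) :
    symmProjectionIdeal ι K d ≤ RingHom.ker φ ↔
      IsIdempotentElem ((symmMvPolynomialX ι K).map φ) ∧
        ((symmMvPolynomialX ι K).map φ).trace = d := by
  rw [symmProjectionIdeal, sup_le_iff, symmIdempotentIdeal_le_ker_iff,
    Ideal.span_singleton_le_iff_mem, RingHom.mem_ker, map_sub, map_natCast, sub_eq_zero,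
    trace_map_symmMvPolynomialX]

variable (ι K)

lemma fg_symmIdempotentIdeal : (symmIdempotentIdeal ι K).FG := by
  refine Submodule.fg_span ((Set.finite_range fun p : ι × ι =>
    (symmMvPolynomialX ι K ^ 2 - symmMvPolynomialX ι K) p.1 p.2).subset ?_)
  rintro _ ⟨i, j, rfl⟩
  exact ⟨(i, j), rfl⟩

lemma fg_symmProjectionIdeal (d : ℕ) : (symmProjectionIdeal ι K d).FG :=
  Submodule.FG.sup (fg_symmIdempotentIdeal ι K) (Submodule.fg_span_singleton _)

lemma symmIdempotentIdeal_eq_iInf :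
    symmIdempotentIdeal ι K = ⨅ d : Fin (Fintype.card ι + 1), symmProjectionIdeal ι K d := by
  refine le_antisymm (le_iInf fun d => le_sup_left) fun f hf => ?_
  let π := Ideal.Quotient.mkₐ K (symmIdempotentIdeal ι K)
  have hker : RingHom.ker π = symmIdempotentIdeal ι K := Ideal.Quotient.mkₐ_ker K _
  have hE := (symmIdempotentIdeal_le_ker_iff π).mp hker.ge
  rw [← hker, RingHom.mem_ker, ← Ideal.mem_bot, ← iInf_span_trace_sub_natCast_eq_bot hE,
    Ideal.mem_iInf]
  intro d
  have hmap : (symmProjectionIdeal ι K d).map π =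
      Ideal.span {((symmMvPolynomialX ι K).map π).trace - (d : ℕ)} := by
    rw [symmProjectionIdeal, Ideal.map_sup, (Ideal.map_eq_bot_iff_le_ker π).mpr hker.ge, bot_sup_eq,
      Ideal.map_span, Set.image_singleton, map_sub, map_natCast, trace_map_symmMvPolynomialX]
  exact hmap ▸ Ideal.mem_map_of_mem π (Ideal.mem_iInf.mp hf d)

end GenericSymmetricMatrix

section Smoothness

universe u v

/-- The polynomial `3 t ^ 2 - 2 t ^ 3` fixes the two roots of `t ^ 2 - t` and its derivative
vanishes there, so that it squares the defect `t ^ 2 - t`. -/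
lemma isIdempotentElem_three_nsmul_sq_sub_two_nsmul_cube {A : Type*} [Ring A] {t : A}
    (ht : (t * t - t) * (t * t - t) = 0) : IsIdempotentElem (3 • t ^ 2 - 2 • t ^ 3) := by
  have hdefect : (3 • t ^ 2 - 2 • t ^ 3) * (3 • t ^ 2 - 2 • t ^ 3) - (3 • t ^ 2 - 2 • t ^ 3) =
      (t * t - t) * (t * t - t) * (4 • t ^ 2 - 4 • t - 3) := by
    noncomm_ring
  rw [ht, zero_mul] at hdefect
  exact sub_eq_zero.mp hdefect

lemma mul_eq_zero_of_map_mk_eq_zero {m B : Type*} [Fintype m] [CommRing B] {I : Ideal B}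
    (hI : I ^ 2 = ⊥) {M N : Matrix m m B} (hM : M.map (Ideal.Quotient.mk I) = 0)
    (hN : N.map (Ideal.Quotient.mk I) = 0) : M * N = 0 := by
  ext i j
  refine Finset.sum_eq_zero fun k _ => ?_
  rw [← Ideal.mem_bot, ← hI, sq]
  exact Ideal.mul_mem_mul (Ideal.Quotient.eq_zero_iff_mem.mp (congrFun (congrFun hM i) k))
    (Ideal.Quotient.eq_zero_iff_mem.mp (congrFun (congrFun hN k) j))

lemma exists_isSymm_isIdempotentElem_map_mk_eq {m B : Type*} [Fintype m] [CommRing B]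
    {I : Ideal B} (hI : I ^ 2 = ⊥) {E : Matrix m m (B ⧸ I)} (hs : E.IsSymm)
    (hE : IsIdempotentElem E) :
    ∃ F : Matrix m m B, F.IsSymm ∧ IsIdempotentElem F ∧ F.map (Ideal.Quotient.mk I) = E := by
  classical
  let π : Matrix m m B →+* Matrix m m (B ⧸ I) := (Ideal.Quotient.mk I).mapMatrix
  obtain ⟨σ, hσ⟩ := (Ideal.Quotient.mk_surjective (I := I)).hasRightInverse
  have hT : π (E.map σ) = E := Matrix.ext fun i j => hσ (E i j)
  have hTs : (E.map σ).IsSymm := hs.map σ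
  generalize E.map σ = T at hT hTs
  have hdefect : π (T * T - T) = 0 := by rw [map_sub, map_mul, hT, hE.eq, sub_self]
  refine ⟨3 • T ^ 2 - 2 • T ^ 3, ?_, isIdempotentElem_three_nsmul_sq_sub_two_nsmul_cube
    (mul_eq_zero_of_map_mk_eq_zero hI hdefect hdefect), ?_⟩
  · exact ((hTs.pow 2).smul 3).sub ((hTs.pow 3).smul 2)
  · change π _ = E
    rw [map_sub, map_nsmul, map_nsmul, map_pow, map_pow, hT, hE.pow_eq two_ne_zero,
      hE.pow_eq three_ne_zero, succ_nsmul E 2,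
      add_sub_cancel_left]

lemma formallySmooth_quotient_of_exists_lift {K : Type u} {R : Type v} [CommRing K] [CommRing R]
    [Algebra K R] (J : Ideal R)
    (H : ∀ {B : Type max u v} [CommRing B] [Algebra K B] {I : Ideal B}, I ^ 2 = ⊥ →
      ∀ φ : R →ₐ[K] B ⧸ I, J ≤ RingHom.ker φ →
        ∃ ψ : R →ₐ[K] B, J ≤ RingHom.ker ψ ∧ (Ideal.Quotient.mkₐ K I).comp ψ = φ) :
    Algebra.FormallySmooth K (R ⧸ J) := by
  refine Algebra.FormallySmooth.of_comp_surjective fun B _ _ I hI f => ?_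
  obtain ⟨ψ, hψ, hψf⟩ := H hI (f.comp (Ideal.Quotient.mkₐ K J)) fun x hx => by
    simp [RingHom.mem_ker, Ideal.Quotient.eq_zero_iff_mem.mpr hx]
  refine ⟨Ideal.Quotient.liftₐ J ψ fun a ha => hψ ha, Ideal.Quotient.algHom_ext _ ?_⟩
  rw [← hψf]
  rfl

variable {ι K : Type*} [Fintype ι] [DecidableEq ι] [CommRing K]

lemma exists_lift_of_symmIdempotentIdeal_le_ker {B : Type*} [CommRing B] [Algebra K B]
    {I : Ideal B} (hI : I ^ 2 = ⊥) (φ : MvPolynomial (Sym2 ι) K →ₐ[K] B ⧸ I)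
    (hφ : symmIdempotentIdeal ι K ≤ RingHom.ker φ) :
    ∃ ψ : MvPolynomial (Sym2 ι) K →ₐ[K] B, symmIdempotentIdeal ι K ≤ RingHom.ker ψ ∧
      (Ideal.Quotient.mkₐ K I).comp ψ = φ := by
  obtain ⟨F, hFs, hF, hFφ⟩ := exists_isSymm_isIdempotentElem_map_mk_eq hI
    (isSymm_map_symmMvPolynomialX φ) ((symmIdempotentIdeal_le_ker_iff φ).mp hφ)
  have hψ := symmMvPolynomialX_map_symmAeval (K := K) hFs
  refine ⟨symmAeval K hFs, (symmIdempotentIdeal_le_ker_iff _).mpr (hψ.symm ▸ hF),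
    algHom_ext_of_map_symmMvPolynomialX_eq ?_⟩
  exact (congrArg (·.map (Ideal.Quotient.mk I)) hψ).trans hFφ

lemma exists_lift_of_symmProjectionIdeal_le_ker [Algebra ℚ K] (d : ℕ) {B : Type*} [CommRing B]
    [Algebra K B] {I : Ideal B} (hI : I ^ 2 = ⊥) (φ : MvPolynomial (Sym2 ι) K →ₐ[K] B ⧸ I)
    (hφ : symmProjectionIdeal ι K d ≤ RingHom.ker φ) :
    ∃ ψ : MvPolynomial (Sym2 ι) K →ₐ[K] B, symmProjectionIdeal ι K d ≤ RingHom.ker ψ ∧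
      (Ideal.Quotient.mkₐ K I).comp ψ = φ := by
  obtain ⟨ψ, hψ, rfl⟩ := exists_lift_of_symmIdempotentIdeal_le_ker hI φ (le_sup_left.trans hφ)
  have hE := (symmIdempotentIdeal_le_ker_iff ψ).mp hψ
  have hmem : ((symmMvPolynomialX ι K).map ψ).trace - d ∈ I := by
    have htrace := ((symmProjectionIdeal_le_ker_iff d _).mp hφ).2
    rw [trace_map_symmMvPolynomialX] at htrace ⊢
    rw [← Ideal.Quotient.eq_zero_iff_mem, map_sub, map_natCast, sub_eq_zero]
    exact htrace
  have hnil : IsNilpotent (((symmMvPolynomialX ι K).map ψ).trace - d) :=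
    ⟨2, by simpa [hI] using Ideal.pow_mem_pow hmem 2⟩
  let : Algebra ℚ B := Algebra.compHom B (algebraMap ℚ K)
  exact ⟨ψ, (symmProjectionIdeal_le_ker_iff d ψ).mpr
    ⟨hE, trace_eq_natCast_of_isNilpotent_sub hE hnil⟩, rfl⟩

variable (ι K)

theorem smooth_quotient_symmIdempotentIdeal :
    Algebra.Smooth K (MvPolynomial (Sym2 ι) K ⧸ symmIdempotentIdeal ι K) where
  formallySmooth :=
    formallySmooth_quotient_of_exists_lift _ exists_lift_of_symmIdempotentIdeal_le_ker
  finitePresentation := .quotient (fg_symmIdempotentIdeal ι K)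

theorem smooth_quotient_symmProjectionIdeal [Algebra ℚ K] (d : ℕ) :
    Algebra.Smooth K (MvPolynomial (Sym2 ι) K ⧸ symmProjectionIdeal ι K d) where
  formallySmooth :=
    formallySmooth_quotient_of_exists_lift _ (exists_lift_of_symmProjectionIdeal_le_ker d)
  finitePresentation := .quotient (fg_symmProjectionIdeal ι K d)

end Smoothness

section Frames

variable (κ ι K : Type*) [Fintype κ] [DecidableEq κ] [Fintype ι] [CommRing K]

/-- The coordinate ring of the space of frames: the `κ × ι` matrices `A` with `A Aᵀ` invertible,
that is, the bases of the nondegenerate subspaces of rank `card κ`. -/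
abbrev FrameRing : Type _ :=
  Localization.Away (mvPolynomialX κ ι K * (mvPolynomialX κ ι K)ᵀ).det

/-- The generic frame, with entries in the coordinate ring of the space of frames. -/
noncomputable def genericFrame : Matrix κ ι (FrameRing κ ι K) :=
  (mvPolynomialX κ ι K).map (algebraMap _ _)

lemma isUnit_det_genericFrame : IsUnit (genericFrame κ ι K * (genericFrame κ ι K)ᵀ).det := by
  rw [genericFrame, det_map_mul_transpose_map]
  exact IsLocalization.Away.algebraMap_isUnit _

variable {κ ι} in
lemma isDomain_frameRing [IsDomain K] (e : κ ↪ ι) : IsDomain (FrameRing κ ι K) := by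
  classical
  refine IsLocalization.isDomain_localization (powers_le_nonZeroDivisors_of_noZeroDivisors ?_)
  intro hdet
  let A : Matrix κ ι K := (1 : Matrix ι ι K).submatrix e id
  let ev : MvPolynomial (κ × ι) K →+* K := MvPolynomial.eval₂Hom (RingHom.id K) fun p => A p.1 p.2
  have hev : (mvPolynomialX κ ι K).map ev = A := mvPolynomialX_map_eval₂ (RingHom.id K) A
  have hA : A * Aᵀ = 1 :=
    (submatrix_mul_transpose_submatrix isSymm_one .one e).trans (submatrix_one e e.injective)
  have h := det_map_mul_transpose_map ev (mvPolynomialX κ ι K)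
  rw [hev, hA, det_one, hdet, map_zero] at h
  exact one_ne_zero h

variable {κ ι K} {S : Type*} [CommRing S] [Algebra K S]

lemma exists_genericFrame_map_eq {A : Matrix κ ι S} (hA : IsUnit (A * Aᵀ).det) :
    ∃ ρ : FrameRing κ ι K →ₐ[K] S, (genericFrame κ ι K).map ρ = A := by
  let ev : MvPolynomial (κ × ι) K →ₐ[K] S := MvPolynomial.aeval fun p => A p.1 p.2
  have hev : (mvPolynomialX κ ι K).map ev = A := mvPolynomialX_map_eval₂ (algebraMap K S) A
  have hunit : IsUnit (ev (mvPolynomialX κ ι K * (mvPolynomialX κ ι K)ᵀ).det) := by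
    rwa [← hev, ← AlgHom.coe_toRingHom, det_map_mul_transpose_map] at hA
  refine ⟨IsLocalization.Away.liftAlgHom _ hunit, ?_⟩
  ext i j
  rw [← hev]
  exact IsLocalization.Away.lift_eq _ hunit _

variable (κ ι K)

/-- The homomorphism of coordinate rings that corresponds to sending a frame to the orthogonal
projection onto the subspace it spans. -/
noncomputable def frameProjection : MvPolynomial (Sym2 ι) K →ₐ[K] FrameRing κ ι K :=
  symmAeval K (isSymm_rowProj (genericFrame κ ι K))

variable {κ ι K}

lemma symmMvPolynomialX_map_frameProjection :
    (symmMvPolynomialX ι K).map (frameProjection κ ι K) = rowProj (genericFrame κ ι K) :=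
  symmMvPolynomialX_map_symmAeval _

variable [DecidableEq ι]

lemma symmProjectionIdeal_le_ker_frameProjection :
    symmProjectionIdeal ι K (Fintype.card κ) ≤ RingHom.ker (frameProjection κ ι K) := by
  rw [symmProjectionIdeal_le_ker_iff, symmMvPolynomialX_map_frameProjection]
  exact ⟨isIdempotentElem_rowProj (isUnit_det_genericFrame κ ι K),
    trace_rowProj (isUnit_det_genericFrame κ ι K)⟩

variable [Algebra ℚ K]

lemma exists_comp_frameProjection_eq (ψ : MvPolynomial (Sym2 ι) K →ₐ[K] S)
    (hψ : symmProjectionIdeal ι K (Fintype.card κ) ≤ RingHom.ker ψ) (a : κ → ι)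
    (ha : IsUnit (((symmMvPolynomialX ι K).map ψ).submatrix a a).det) :
    ∃ ρ : FrameRing κ ι K →ₐ[K] S, ρ.comp (frameProjection κ ι K) = ψ := by
  let : Algebra ℚ S := Algebra.compHom S (algebraMap ℚ K)
  have hs := isSymm_map_symmMvPolynomialX ψ
  obtain ⟨hP, ht⟩ := (symmProjectionIdeal_le_ker_iff _ ψ).mp hψ
  obtain ⟨ρ, hρ⟩ := exists_genericFrame_map_eq (K := K)
    (A := ((symmMvPolynomialX ι K).map ψ).submatrix a id)
    (by rwa [submatrix_mul_transpose_submatrix hs hP])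
  refine ⟨ρ, algHom_ext_of_map_symmMvPolynomialX_eq ?_⟩
  calc (symmMvPolynomialX ι K).map (ρ.comp (frameProjection κ ι K))
      = ((symmMvPolynomialX ι K).map (frameProjection κ ι K)).map ρ := rfl
    _ = (rowProj (genericFrame κ ι K)).map ρ := by rw [symmMvPolynomialX_map_frameProjection]
    _ = rowProj ((genericFrame κ ι K).map ρ) :=
      map_rowProj (ρ : FrameRing κ ι K →+* S) (isUnit_det_genericFrame κ ι K)
    _ = (symmMvPolynomialX ι K).map ψ := by rw [hρ, rowProj_submatrix hs hP ht a ha]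

/-- `Spec S` is covered by the basic open sets where some principal minor of size `card κ` of the
image of `P` is invertible, and over each of them that image comes from a frame. -/
lemma ker_frameProjection_le_ker (ψ : MvPolynomial (Sym2 ι) K →ₐ[K] S)
    (hψ : symmProjectionIdeal ι K (Fintype.card κ) ≤ RingHom.ker ψ) :
    RingHom.ker (frameProjection κ ι K) ≤ RingHom.ker ψ := by
  let : Algebra ℚ S := Algebra.compHom S (algebraMap ℚ K)
  obtain ⟨hP, ht⟩ := (symmProjectionIdeal_le_ker_iff _ ψ).mp hψ
  intro f hf
  refine Localization.algebraMap_injective_of_span_eq_top _ (span_det_submatrix_eq_top hP ht)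
    (funext ?_)
  rintro ⟨_, a, rfl⟩
  set P := (symmMvPolynomialX ι K).map ψ
  let loc : S →ₐ[K] Localization.Away (P.submatrix a a).det := Algebra.algHom K S _
  have hunit : IsUnit (((symmMvPolynomialX ι K).map (loc.comp ψ)).submatrix a a).det := by
    have h : (((symmMvPolynomialX ι K).map (loc.comp ψ)).submatrix a a).det =
        loc (P.submatrix a a).det := (AlgHom.map_det loc _).symm
    exact h ▸ IsLocalization.Away.algebraMap_isUnit _
  obtain ⟨ρ, hρ⟩ := exists_comp_frameProjection_eq (loc.comp ψ)
    (fun g hg => by simp [RingHom.mem_ker, RingHom.mem_ker.mp (hψ hg)]) a hunit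
  change (loc.comp ψ) f = loc 0
  rw [← hρ, AlgHom.comp_apply, RingHom.mem_ker.mp hf, map_zero, map_zero]

variable (κ ι K)

lemma ker_frameProjection :
    RingHom.ker (frameProjection κ ι K) = symmProjectionIdeal ι K (Fintype.card κ) := by
  have hker := Ideal.Quotient.mkₐ_ker K (symmProjectionIdeal ι K (Fintype.card κ))
  refine le_antisymm ?_ symmProjectionIdeal_le_ker_frameProjection
  exact (ker_frameProjection_le_ker _ hker.ge).trans hker.le

theorem isPrime_symmProjectionIdeal [IsDomain K] {d : ℕ} (hd : d ≤ Fintype.card ι) :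
    (symmProjectionIdeal ι K d).IsPrime := by
  obtain ⟨e⟩ : Nonempty (Fin d ↪ ι) := Function.Embedding.nonempty_of_card_le (by simpa using hd)
  have := isDomain_frameRing K e
  have h := RingHom.ker_isPrime (frameProjection (Fin d) ι K)
  rwa [ker_frameProjection, Fintype.card_fin] at h

theorem isRadical_symmIdempotentIdeal [IsDomain K] : (symmIdempotentIdeal ι K).IsRadical := by
  rw [symmIdempotentIdeal_eq_iInf]
  exact Ideal.isRadical_iInf _ fun d =>
    (isPrime_symmProjectionIdeal ι K (Nat.le_of_lt_succ d.isLt)).isRadical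

end Frames

theorem mainTheorem2_general (ι K L : Type*) [Fintype ι] [DecidableEq ι] [Field K] [CharZero K]
    [Field L] [IsAlgClosed L] [Algebra K L] :
    (symmIdempotentIdeal ι K).IsRadical ∧
    Algebra.Smooth K (MvPolynomial (Sym2 ι) K ⧸ symmIdempotentIdeal ι K) ∧
    ∀ d : ℕ, d ≤ Fintype.card ι →
      (symmProjectionIdeal ι K d).IsPrime ∧
      MvPolynomial.vanishingIdeal K (MvPolynomial.zeroLocus L (symmProjectionIdeal ι K d)) =
        symmProjectionIdeal ι K d ∧
      Algebra.Smooth K (MvPolynomial (Sym2 ι) K ⧸ symmProjectionIdeal ι K d) := by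
  refine ⟨isRadical_symmIdempotentIdeal ι K, smooth_quotient_symmIdempotentIdeal ι K,
    fun d hd => ?_⟩
  have := isPrime_symmProjectionIdeal ι K hd
  exact ⟨this, MvPolynomial.IsPrime.vanishingIdeal_zeroLocus _,
    smooth_quotient_symmProjectionIdeal ι K d⟩

theorem mainTheorem2 (n : ℕ) :
    (idempotentIdeal n).IsRadical ∧
    Algebra.Smooth ℂ (SymMatRing n ⧸ idempotentIdeal n) ∧
    ∀ d : ℕ, d ≤ n →
      (projectionIdeal d n).IsPrime ∧
      MvPolynomial.vanishingIdeal ℂ (pGr d n) = projectionIdeal d n ∧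
      Algebra.Smooth ℂ (SymMatRing n ⧸ projectionIdeal d n) := by
  have h := mainTheorem2_general (Fin n) ℂ ℂ
  rwa [Fintype.card_fin] at h
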